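/- Let $B^H=(B^H(t))_{t\ge 0}$ be a fractional Brownian motion with Hurst parameter $H\in(1/2,1)$, i.e. a centered Gaussian process with covariance $\mathbb E[B^H(s)B^H(t)]=\frac12\left(t^{2H}+s^{2H}-|t-s|^{2H}\right)$. Let $\kappa\ge 2H$, $\lambda>0$ and $\mu>0$ be such that either $\kappa>2H$, or $\kappa=2H$ and $-\lambda+\mu^2<0$. Let $f,g:[0,\infty)\times\mathbb R\to\mathbb R$ satisfy, for all $t>0$ and $x\in\mathbb R$, $$x f(t,x)\le -\lambda\kappa t^{\kappa-1}x^2,\qquad |g(t,x)|\le \mu|x|.$$ Fix a step size $\Delta t>0$ and a constant $X_0\in\mathbb R$, and put $t_n=n\Delta t$, $V_n^H=B^H(t_{n+1})-B^H(t_n)$. For $\theta\in[0,1]$, the stochastic theta method (STM) for the equation $dX(t)=f(t,X(t))\,dt+g(t,X(t))\,dB^H(t)$ is the implicit recursion $$X_{n+1}=X_n+\theta f(t_{n+1},X_{n+1})\Delta t+(1-\theta)f(t_n,X_n)\Delta t+g(t_n,X_n)V_n^H,\qquad n=0,1,2,\dots$$ The method is called mean square stable if every sequence of random variables $(X_n)$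 that starts at $X_0$ and satisfies this recursion almost surely has $\mathbb E|X_n|^2<\infty$ for all $n$ and $\lim_{n\to\infty}\mathbb E|X_n|^2=0$. Then: (i) The STM with $\theta=1$ (the backward Euler method) is mean square stable. (ii) If in addition there is a constant $\bar\lambda>0$ with $|f(t,x)|\le\bar\lambda\kappa t^{\kappa-1}|x|$ for all $t>0$ and $x\in\mathbb R$, then the STM is mean square stable for every $\theta$ with $$\frac{\sqrt6\,e\,\bar\lambda/\lambda}{\sqrt6\,e\,\bar\lambda/\lambda+1}\le\theta<1 .$$ -/

import Mathlib

open MeasureTheory ProbabilityTheory Filter Topology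
open scoped NNReal

/-- `B` is a fractional Brownian motion with Hurst parameter `H` under `P`: a centered Gaussian
process on `[0, ∞)` with covariance `(t^{2H} + s^{2H} - |t - s|^{2H}) / 2`. -/
structure IsFractionalBrownianMotion {Ω : Type*} [MeasurableSpace Ω] (H : ℝ)
    (B : ℝ≥0 → Ω → ℝ) (P : Measure Ω) : Prop where
  isGaussianProcess : IsGaussianProcess B P
  integral_eq_zero : ∀ t, ∫ ω, B t ω ∂P = 0
  covariance_eq : ∀ s t, cov[B s, B t; P] =
    ((t : ℝ) ^ (2 * H) + (s : ℝ) ^ (2 * H) - |(t : ℝ) - (s : ℝ)| ^ (2 * H)) / 2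

/-- The grid point `t_n = n Δt`. -/
def gridTime (dt : ℝ≥0) (n : ℕ) : ℝ≥0 := n * dt

/-- The increment `V_n = B(t_{n+1}) - B(t_n)`. -/
def gridIncrement {Ω : Type*} (B : ℝ≥0 → Ω → ℝ) (dt : ℝ≥0) (n : ℕ) (ω : Ω) : ℝ :=
  B (gridTime dt (n + 1)) ω - B (gridTime dt n) ω

/-- The sequence of random variables `X` is produced by the stochastic theta method with parameter
`θ` and step size `dt`, started at the constant `x₀`, for `dX = f(t,X) dt + g(t,X) dB`. The scheme
is implicit in `X (n + 1)`; any measurable choice of solutions is allowed. -/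
structure IsStochasticThetaMethod {Ω : Type*} [MeasurableSpace Ω] (P : Measure Ω)
    (f g : ℝ → ℝ → ℝ) (B : ℝ≥0 → Ω → ℝ) (θ : ℝ) (dt : ℝ≥0) (x₀ : ℝ) (X : ℕ → Ω → ℝ) : Prop where
  aemeasurable : ∀ n, AEMeasurable (X n) P
  initial : ∀ᵐ ω ∂P, X 0 ω = x₀
  step : ∀ n, ∀ᵐ ω ∂P,
    X (n + 1) ω = X n ω + θ * f (gridTime dt (n + 1)) (X (n + 1) ω) * dt
      + (1 - θ) * f (gridTime dt n) (X n ω) * dt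
      + g (gridTime dt n) (X n ω) * gridIncrement B dt n ω

/-- Mean square stability: all second moments are finite, and `E |X_n|² → 0`. -/
def MeanSquareStable {Ω : Type*} [MeasurableSpace Ω] (P : Measure Ω) (X : ℕ → Ω → ℝ) : Prop :=
  (∀ n, MemLp (X n) 2 P) ∧ Tendsto (fun n => ∫ ω, |X n ω| ^ 2 ∂P) atTop (𝓝 0)

/-- Monotone condition: `x f(t,x) ≤ -λ κ t^{κ-1} x²` for all `t > 0` and `x`. -/
def MonotoneCondition (κ lam : ℝ) (f : ℝ → ℝ → ℝ) : Prop :=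
  ∀ t x : ℝ, 0 < t → x * f t x ≤ -lam * κ * t ^ (κ - 1) * x ^ 2

/-- Linear growth of the drift: `|f(t,x)| ≤ Λ κ t^{κ-1} |x|` for all `t > 0` and `x`. -/
def DriftLinearGrowth (κ lamBar : ℝ) (f : ℝ → ℝ → ℝ) : Prop :=
  ∀ t x : ℝ, 0 < t → |f t x| ≤ lamBar * κ * t ^ (κ - 1) * |x|

/-- Uniform linear growth of the diffusion: `|g(t,x)| ≤ μ |x|` for all `t > 0` and `x`. -/
def UniformLinearGrowth (μ : ℝ) (g : ℝ → ℝ → ℝ) : Prop :=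
  ∀ t x : ℝ, 0 < t → |g t x| ≤ μ * |x|


/-!
The monotone drift gives the resolvent bound `|X_{n+1}| (1 + b_n) ≤ |explicit data|` with
`b_n = θ λ κ t_n^{κ-1} Δt → ∞`. If the explicit drift is at most `ρ b_n |X_n| / Δt` with `ρ < 1`,
then pathwise `|X_n| ≤ C ∏_{k<n} r_k exp |c_k V_k|`, where `r_k = (1 + ρ b_k) / (1 + b_k) → ρ` and
`c_k = μ / (1 + ρ b_k)`. Replacing `exp |y|` by `exp δ · cosh (K y)` and expanding the product of
hyperbolic cosines over all choices of signs, the expectation of the exponentials is at most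
`exp (n δ + K² R_n ∑_{k<n} c_k² / 2)`, where `R_n` bounds the row sums of the covariance matrix
of `V_0, …, V_{n-1}` (Schur test). For fractional Brownian motion the rows telescope and
`R_n = O(n^{2H-1})`, while `c_k² = o(k^{1-2H})` as soon as `κ > H + 1/2`. The exponent is therefore
at most `2 δ n` for large `n`, and for small `δ` it is beaten by `∏ r_k²`.
-/

section PowersAndProducts

lemma rpow_sub_rpow_sub_one_le {p x : ℝ} (hp : 1 ≤ p) (hx : 1 ≤ x) :
    x ^ p - (x - 1) ^ p ≤ p * x ^ (p - 1) := by
  have h := (convexOn_rpow hp).slope_le_of_hasDerivAt (Set.mem_Ici.2 (sub_nonneg.2 hx))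
    (Set.mem_Ici.2 (zero_le_one.trans hx)) (sub_one_lt x) (Real.hasDerivAt_rpow_const (.inr hp))
  simpa [slope_def_field] using h

lemma mul_rpow_sub_one_le_rpow_sub_rpow {q x : ℝ} (hq0 : 0 ≤ q) (hq1 : q ≤ 1) (hx : 0 ≤ x) :
    q * (x + 1) ^ (q - 1) ≤ (x + 1) ^ q - x ^ q := by
  have h := (Real.concaveOn_rpow hq0 hq1).le_slope_of_hasDerivAt (Set.mem_Ici.2 hx)
    (Set.mem_Ici.2 (by positivity)) (lt_add_one x)
    (Real.hasDerivAt_rpow_const (.inl (by positivity)))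
  simpa [slope_def_field] using h

lemma isBigO_rpow_sub_one_rpow_succ_sub_rpow {q : ℝ} (hq0 : 0 < q) (hq1 : q ≤ 1) :
    (fun k : ℕ => (k : ℝ) ^ (q - 1)) =O[atTop]
      fun k : ℕ => ((k + 1 : ℕ) : ℝ) ^ q - (k : ℝ) ^ q := by
  refine .of_bound (q * 2 ^ (q - 1))⁻¹ ?_
  filter_upwards [eventually_ge_atTop 1] with k hk
  have hk1 : (1 : ℝ) ≤ k := by exact_mod_cast hk
  have hle : q * 2 ^ (q - 1) * (k : ℝ) ^ (q - 1) ≤ ((k + 1 : ℕ) : ℝ) ^ q - (k : ℝ) ^ q := by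
    calc q * 2 ^ (q - 1) * (k : ℝ) ^ (q - 1) = q * (2 * k) ^ (q - 1) := by
          rw [Real.mul_rpow zero_le_two k.cast_nonneg, mul_assoc]
      _ ≤ q * ((k : ℝ) + 1) ^ (q - 1) := by
          gcongr q * ?_
          exact Real.rpow_le_rpow_of_nonpos (by positivity) (by linarith) (by linarith)
      _ ≤ _ := by
          push_cast
          exact mul_rpow_sub_one_le_rpow_sub_rpow hq0.le hq1 k.cast_nonneg
  rw [Real.norm_of_nonneg (by positivity), ← div_eq_inv_mul, le_div_iff₀' (by positivity)]
  exact hle.trans (le_abs_self _)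

lemma isLittleO_sum_range_rpow {q : ℝ} (hq0 : 0 < q) (hq1 : q ≤ 1) {u : ℕ → ℝ}
    (hu : u =o[atTop] fun k : ℕ => (k : ℝ) ^ (q - 1)) :
    (fun n => ∑ k ∈ Finset.range n, u k) =o[atTop] fun n : ℕ => (n : ℝ) ^ q := by
  have htelescope (n : ℕ) :
      ∑ k ∈ Finset.range n, (((k + 1 : ℕ) : ℝ) ^ q - (k : ℝ) ^ q) = (n : ℝ) ^ q := by
    rw [Finset.sum_range_sub fun k : ℕ => (k : ℝ) ^ q, Nat.cast_zero, Real.zero_rpow hq0.ne',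
      sub_zero]
  have h := (hu.trans_isBigO (isBigO_rpow_sub_one_rpow_succ_sub_rpow hq0 hq1)).sum_range
    (fun k => sub_nonneg.2 (by gcongr; exact k.le_succ)) (by
      simp only [htelescope]
      exact (tendsto_rpow_atTop hq0).comp tendsto_natCast_atTop_atTop)
  simpa only [htelescope] using h

lemma tendsto_prod_range_zero_of_eventually_le {u : ℕ → ℝ} (hu0 : ∀ k, 0 ≤ u k) {ρ : ℝ}
    (hρ : ρ < 1) (hu : ∀ᶠ k in atTop, u k ≤ ρ) :
    Tendsto (fun n => ∏ k ∈ Finset.range n, u k) atTop (𝓝 0) := by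
  refine (summable_of_ratio_norm_eventually_le hρ ?_).tendsto_atTop_zero
  filter_upwards [hu] with n hn
  rw [Finset.prod_range_succ, norm_mul, mul_comm, Real.norm_of_nonneg (hu0 n)]
  gcongr

lemma le_mul_prod_range {x u : ℕ → ℝ} {C : ℝ} (hu : ∀ k, 0 ≤ u k) (hx0 : x 0 ≤ C)
    (hx1 : x 1 ≤ C * u 0) (hstep : ∀ n, x (n + 2) ≤ x (n + 1) * u (n + 1)) :
    ∀ n, x n ≤ C * ∏ k ∈ Finset.range n, u k
  | 0 => by simpa using hx0
  | 1 => by simpa using hx1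
  | n + 2 => by
    rw [Finset.prod_range_succ, ← mul_assoc]
    exact (hstep n).trans
      (mul_le_mul_of_nonneg_right (le_mul_prod_range hu hx0 hx1 hstep (n + 1)) (hu _))

end PowersAndProducts

section GaussianExponentialMoments

lemma sum_sum_mul_le_of_sum_abs_le {ι : Type*} {s : Finset ι} {K : ι → ι → ℝ} {R : ℝ}
    (hsymm : ∀ j k, K j k = K k j) (hR : ∀ k ∈ s, ∑ j ∈ s, |K j k| ≤ R) (a : ι → ℝ) :
    ∑ j ∈ s, ∑ k ∈ s, a j * a k * K j k ≤ R * ∑ k ∈ s, a k ^ 2 := by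
  have hweighted : ∑ k ∈ s, ∑ j ∈ s, a k ^ 2 * |K j k| ≤ R * ∑ k ∈ s, a k ^ 2 := by
    rw [Finset.mul_sum]
    refine Finset.sum_le_sum fun k hk => ?_
    rw [← Finset.mul_sum, mul_comm R]
    exact mul_le_mul_of_nonneg_left (hR k hk) (sq_nonneg _)
  have hswap : ∑ j ∈ s, ∑ k ∈ s, a k ^ 2 * |K j k| = ∑ k ∈ s, ∑ j ∈ s, a k ^ 2 * |K j k| :=
    Finset.sum_comm
  have hrelabel : ∑ j ∈ s, ∑ k ∈ s, a j ^ 2 * |K j k| = ∑ k ∈ s, ∑ j ∈ s, a k ^ 2 * |K j k| :=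
    Finset.sum_congr rfl fun j _ => Finset.sum_congr rfl fun k _ => by rw [hsymm]
  have hterm (j k : ι) : a j * a k * K j k ≤ (a j ^ 2 * |K j k| + a k ^ 2 * |K j k|) / 2 := by
    have hyoung : |a j * a k| ≤ (a j ^ 2 + a k ^ 2) / 2 := by
      rw [abs_mul, ← sq_abs (a j), ← sq_abs (a k)]
      linarith [two_mul_le_add_sq |a j| |a k|]
    calc a j * a k * K j k ≤ |a j * a k| * |K j k| := by rw [← abs_mul]; exact le_abs_self _
      _ ≤ (a j ^ 2 + a k ^ 2) / 2 * |K j k| := by gcongr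
      _ = _ := by ring
  calc ∑ j ∈ s, ∑ k ∈ s, a j * a k * K j k
      ≤ ∑ j ∈ s, ∑ k ∈ s, (a j ^ 2 * |K j k| + a k ^ 2 * |K j k|) / 2 :=
        Finset.sum_le_sum fun j _ => Finset.sum_le_sum fun k _ => hterm j k
    _ = ∑ k ∈ s, ∑ j ∈ s, a k ^ 2 * |K j k| := by
        simp_rw [← Finset.sum_div, Finset.sum_add_distrib]
        rw [hswap, hrelabel, add_self_div_two]
    _ ≤ R * ∑ k ∈ s, a k ^ 2 := hweighted

lemma prod_cosh_eq_sum_powerset {ι : Type*} [DecidableEq ι] (s : Finset ι) (x : ι → ℝ) :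
    ∏ k ∈ s, Real.cosh (x k) =
      (∑ t ∈ s.powerset, Real.exp (∑ k ∈ s, if k ∈ t then x k else -x k)) / 2 ^ s.card := by
  simp_rw [Real.cosh_eq, Finset.prod_div_distrib, Finset.prod_const, Finset.prod_add]
  congr 1
  refine Finset.sum_congr rfl fun t ht => ?_
  have hinter : s ∩ t = t := Finset.inter_eq_right.2 (Finset.mem_powerset.1 ht)
  rw [Finset.sum_ite, Real.exp_add, Real.exp_sum, Real.exp_sum, Finset.filter_mem_eq_inter, hinter,
    Finset.filter_notMem_eq_sdiff]

/-- The crude bound `exp |y| ≤ 2 cosh y` would cost a factor `2` per time step; the loss here is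
`exp δ` with `δ` as small as desired. -/
lemma exp_abs_le_exp_mul_cosh {δ : ℝ} (hδ : 0 < δ) (y : ℝ) :
    Real.exp |y| ≤ Real.exp δ * Real.cosh ((1 + Real.log 2 / δ) * y) := by
  set K := 1 + Real.log 2 / δ
  rcases le_total |y| δ with hy | hy
  · calc Real.exp |y| ≤ Real.exp δ * 1 := by rw [mul_one]; gcongr
      _ ≤ _ := by gcongr; exact Real.one_le_cosh _
  · have hlog : Real.log 2 ≤ Real.log 2 / δ * |y| := by
      rw [div_mul_eq_mul_div, le_div_iff₀ hδ]
      gcongr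
    have hK : 0 < K := by positivity
    calc Real.exp |y| ≤ Real.exp (K * |y|) / 2 := by
          rw [le_div_iff₀ two_pos, ← Real.exp_log two_pos, ← Real.exp_add]
          gcongr
          linarith [one_add_mul (Real.log 2 / δ) |y|]
      _ ≤ Real.cosh (K * y) := by
          rw [← Real.cosh_abs (K * y), abs_mul, abs_of_pos hK, Real.cosh_eq]
          gcongr
          exact le_add_of_nonneg_right (Real.exp_pos _).le
      _ ≤ _ := le_mul_of_one_le_left (Real.cosh_pos _).le (Real.one_le_exp hδ.le)

variable {Ω : Type*} [MeasurableSpace Ω] {P : Measure Ω}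

lemma integrable_exp_of_hasGaussianLaw {Z : Ω → ℝ} (hZ : HasGaussianLaw Z P) :
    Integrable (fun ω => Real.exp (Z ω)) P := by
  have h := integrable_exp_mul_gaussianReal (μ := P[Z]) (v := Var[Z; P].toNNReal) 1
  rw [← hZ.map_eq_gaussianReal] at h
  simpa [Function.comp_def] using h.comp_aemeasurable hZ.aemeasurable

lemma integral_exp_of_hasGaussianLaw {Z : Ω → ℝ} (hZ : HasGaussianLaw Z P) :
    ∫ ω, Real.exp (Z ω) ∂P = Real.exp (P[Z] + Var[Z; P] / 2) := by
  simpa [mgf, variance_nonneg] using mgf_gaussianReal hZ.map_eq_gaussianReal 1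

variable {ι : Type*} {V : ι → Ω → ℝ} {s : Finset ι} {R : ℝ}

lemma hasGaussianLaw_sum_mul (hV : IsGaussianProcess V P) (s : Finset ι) (a : ι → ℝ) :
    HasGaussianLaw (fun ω => ∑ k ∈ s, a k * V k ω) P :=
  (hV.smul a).hasGaussianLaw_fun_sum

lemma variance_sum_mul_le_of_sum_abs_covariance_le [IsFiniteMeasure P]
    (hV : ∀ k, MemLp (V k) 2 P) (hR : ∀ k ∈ s, ∑ j ∈ s, |cov[V j, V k; P]| ≤ R) (a : ι → ℝ) :
    Var[fun ω => ∑ k ∈ s, a k * V k ω; P] ≤ R * ∑ k ∈ s, a k ^ 2 := by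
  rw [variance_fun_sum' fun k _ => (hV k).const_mul (a k)]
  simp_rw [covariance_const_mul_left, covariance_const_mul_right, ← mul_assoc]
  exact sum_sum_mul_le_of_sum_abs_le (fun j k => covariance_comm _ _) hR a

lemma integral_exp_sum_mul_le (hV : IsGaussianProcess V P) (h0 : ∀ k, ∫ ω, V k ω ∂P = 0)
    (hR : ∀ k ∈ s, ∑ j ∈ s, |cov[V j, V k; P]| ≤ R) (a : ι → ℝ) :
    ∫ ω, Real.exp (∑ k ∈ s, a k * V k ω) ∂P ≤ Real.exp (R / 2 * ∑ k ∈ s, a k ^ 2) := by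
  have := hV.isProbabilityMeasure
  have hmean : ∫ ω, ∑ k ∈ s, a k * V k ω ∂P = 0 := by
    rw [integral_finsetSum _ fun k _ => (hV.hasGaussianLaw_eval k).integrable.const_mul (a k)]
    simp [integral_const_mul, h0]
  have hvar := variance_sum_mul_le_of_sum_abs_covariance_le
    (fun k => (hV.hasGaussianLaw_eval k).memLp_two) hR a
  rw [integral_exp_of_hasGaussianLaw (hasGaussianLaw_sum_mul hV s a)]
  simp only [hmean, zero_add]
  gcongr
  linarith

lemma integrable_prod_cosh_mul (hV : IsGaussianProcess V P) (s : Finset ι) (a : ι → ℝ) :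
    Integrable (fun ω => ∏ k ∈ s, Real.cosh (a k * V k ω)) P := by
  classical
  simp_rw [prod_cosh_eq_sum_powerset, ← neg_mul, ← ite_mul]
  exact (integrable_finsetSum _ fun t _ => integrable_exp_of_hasGaussianLaw <|
    hasGaussianLaw_sum_mul hV s fun k => if k ∈ t then a k else -a k).div_const _

lemma integral_prod_cosh_mul_le (hV : IsGaussianProcess V P) (h0 : ∀ k, ∫ ω, V k ω ∂P = 0)
    (hR : ∀ k ∈ s, ∑ j ∈ s, |cov[V j, V k; P]| ≤ R) (a : ι → ℝ) :
    ∫ ω, ∏ k ∈ s, Real.cosh (a k * V k ω) ∂P ≤ Real.exp (R / 2 * ∑ k ∈ s, a k ^ 2) := by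
  classical
  simp_rw [prod_cosh_eq_sum_powerset, ← neg_mul, ← ite_mul]
  rw [integral_div, integral_finsetSum _ fun t _ => integrable_exp_of_hasGaussianLaw <|
    hasGaussianLaw_sum_mul hV s fun k => if k ∈ t then a k else -a k,
    div_le_iff₀' (by positivity)]
  have hsign (t : Finset ι) (k : ι) : (if k ∈ t then a k else -a k) ^ 2 = a k ^ 2 := by
    split_ifs
    exacts [rfl, neg_sq _]
  calc ∑ t ∈ s.powerset, ∫ ω, Real.exp (∑ k ∈ s, (if k ∈ t then a k else -a k) * V k ω) ∂P
      ≤ ∑ t ∈ s.powerset, Real.exp (R / 2 * ∑ k ∈ s, a k ^ 2) := by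
        gcongr with t
        simpa only [hsign] using
          integral_exp_sum_mul_le hV h0 hR fun k => if k ∈ t then a k else -a k
    _ = 2 ^ s.card * Real.exp (R / 2 * ∑ k ∈ s, a k ^ 2) := by simp

lemma prod_exp_abs_mul_le {δ : ℝ} (hδ : 0 < δ) (s : Finset ι) (a x : ι → ℝ) :
    ∏ k ∈ s, Real.exp |a k * x k| ≤
      Real.exp (s.card * δ) * ∏ k ∈ s, Real.cosh ((1 + Real.log 2 / δ) * a k * x k) := by
  rw [Real.exp_nat_mul, ← Finset.prod_const, ← Finset.prod_mul_distrib]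
  gcongr with k
  rw [mul_assoc]
  exact exp_abs_le_exp_mul_cosh hδ _

lemma integrable_prod_exp_abs_mul (hV : IsGaussianProcess V P) (s : Finset ι) (a : ι → ℝ) :
    Integrable (fun ω => ∏ k ∈ s, Real.exp |a k * V k ω|) P := by
  have hmeas (k : ι) : AEMeasurable (V k) P := hV.aemeasurable k
  refine ((integrable_prod_cosh_mul hV s fun k => (1 + Real.log 2 / 1) * a k).const_mul
    (Real.exp (s.card * 1))).mono'
    (Finset.aemeasurable_fun_prod _ fun k _ =>
      ((hmeas k).const_mul (a k)).norm.exp).aestronglyMeasurable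
    (.of_forall fun ω => ?_)
  rw [Real.norm_of_nonneg (by positivity)]
  exact prod_exp_abs_mul_le one_pos s a (V · ω)

lemma integral_prod_exp_abs_mul_le (hV : IsGaussianProcess V P) (h0 : ∀ k, ∫ ω, V k ω ∂P = 0)
    (hR : ∀ k ∈ s, ∑ j ∈ s, |cov[V j, V k; P]| ≤ R) {δ : ℝ} (hδ : 0 < δ) (a : ι → ℝ) :
    ∫ ω, ∏ k ∈ s, Real.exp |a k * V k ω| ∂P ≤
      Real.exp (s.card * δ + (1 + Real.log 2 / δ) ^ 2 / 2 * (R * ∑ k ∈ s, a k ^ 2)) := by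
  calc ∫ ω, ∏ k ∈ s, Real.exp |a k * V k ω| ∂P
      ≤ ∫ ω, Real.exp (s.card * δ) *
          ∏ k ∈ s, Real.cosh ((1 + Real.log 2 / δ) * a k * V k ω) ∂P :=
        integral_mono (integrable_prod_exp_abs_mul hV s a)
          ((integrable_prod_cosh_mul hV s _).const_mul _)
          fun ω => prod_exp_abs_mul_le hδ s a (V · ω)
    _ ≤ Real.exp (s.card * δ) *
          Real.exp (R / 2 * ∑ k ∈ s, ((1 + Real.log 2 / δ) * a k) ^ 2) := by
        rw [integral_const_mul]
        gcongr
        exact integral_prod_cosh_mul_le hV h0 hR _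
    _ = _ := by
        rw [← Real.exp_add]
        simp_rw [mul_pow, ← Finset.mul_sum]
        ring_nf

end GaussianExponentialMoments


lemma meanSquareStable_of_ae_sq_le {Ω : Type*} [MeasurableSpace Ω] {P : Measure Ω}
    {X Y : ℕ → Ω → ℝ} (hX : ∀ n, AEMeasurable (X n) P) (hY : ∀ n, Integrable (Y n) P)
    (hle : ∀ n, ∀ᵐ ω ∂P, |X n ω| ^ 2 ≤ Y n ω)
    (hlim : Tendsto (fun n => ∫ ω, Y n ω ∂P) atTop (𝓝 0)) : MeanSquareStable P X := by
  have hint (n : ℕ) : Integrable (fun ω => |X n ω| ^ 2) P := by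
    refine (hY n).mono' ((hX n).norm.pow_const 2).aestronglyMeasurable ?_
    filter_upwards [hle n] with ω hω
    rwa [Real.norm_of_nonneg (by positivity)]
  refine ⟨fun n => (memLp_two_iff_integrable_sq (hX n).aestronglyMeasurable).2 ?_, ?_⟩
  · simpa only [sq_abs] using hint n
  · exact squeeze_zero (fun n => integral_nonneg fun ω => by positivity)
      (fun n => integral_mono_ae (hint n) (hY n) (hle n)) hlim

namespace IsFractionalBrownianMotion

variable {Ω : Type*} [MeasurableSpace Ω] {P : Measure Ω} {H : ℝ} {B : ℝ≥0 → Ω → ℝ}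

lemma isGaussianProcess_gridIncrement (hB : IsFractionalBrownianMotion H B P) (dt : ℝ≥0) :
    IsGaussianProcess (gridIncrement B dt) P := by
  classical
  exact hB.isGaussianProcess.of_isGaussianProcess fun n =>
    ⟨{gridTime dt (n + 1), gridTime dt n},
      .proj ⟨gridTime dt (n + 1), by simp⟩ - .proj ⟨gridTime dt n, by simp⟩, fun _ => rfl⟩

lemma integral_gridIncrement (hB : IsFractionalBrownianMotion H B P) (dt : ℝ≥0) (n : ℕ) :
    ∫ ω, gridIncrement B dt n ω ∂P = 0 := by
  have hint (t : ℝ≥0) : Integrable (B t) P :=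
    (hB.isGaussianProcess.hasGaussianLaw_eval t).integrable
  simp only [gridIncrement, integral_sub (hint _) (hint _), hB.integral_eq_zero, sub_zero]

lemma covariance_gridIncrement (hB : IsFractionalBrownianMotion H B P) (dt : ℝ≥0) (j k : ℕ) :
    cov[gridIncrement B dt j, gridIncrement B dt k; P] =
      (dt : ℝ) ^ (2 * H) / 2 * (|(j : ℝ) - k + 1| ^ (2 * H) - 2 * |(j : ℝ) - k| ^ (2 * H)
        + |(j : ℝ) - k - 1| ^ (2 * H)) := by
  have := hB.isGaussianProcess.isProbabilityMeasure
  have hLp (t : ℝ≥0) : MemLp (B t) 2 P := (hB.isGaussianProcess.hasGaussianLaw_eval t).memLp_two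
  have hscale (x : ℝ) : |x * dt| ^ (2 * H) = (dt : ℝ) ^ (2 * H) * |x| ^ (2 * H) := by
    rw [abs_mul, NNReal.abs_eq, Real.mul_rpow (abs_nonneg _) dt.coe_nonneg, mul_comm]
  have hdiff (n : ℕ) : gridIncrement B dt n = B (gridTime dt (n + 1)) - B (gridTime dt n) := rfl
  rw [hdiff, hdiff, covariance_sub_left (hLp _) (hLp _) ((hLp _).sub (hLp _)),
    covariance_sub_right (hLp _) (hLp _) (hLp _), covariance_sub_right (hLp _) (hLp _) (hLp _)]
  simp only [hB.covariance_eq, gridTime]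
  push_cast
  have hsucc_succ : ((k : ℝ) + 1) * dt - ((j : ℝ) + 1) * dt = -((j : ℝ) - k) * dt := by ring
  have hself_succ : (k : ℝ) * dt - ((j : ℝ) + 1) * dt = -((j : ℝ) - k + 1) * dt := by ring
  have hsucc_self : ((k : ℝ) + 1) * dt - (j : ℝ) * dt = -((j : ℝ) - k - 1) * dt := by ring
  have hself_self : (k : ℝ) * dt - (j : ℝ) * dt = -((j : ℝ) - k) * dt := by ring
  rw [hsucc_succ, hself_succ, hsucc_self, hself_self]
  simp only [hscale, abs_neg]
  ring

lemma covariance_gridIncrement_nonneg (hB : IsFractionalBrownianMotion H B P)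
    (hH : 1 / 2 ≤ H) (dt : ℝ≥0) (j k : ℕ) :
    0 ≤ cov[gridIncrement B dt j, gridIncrement B dt k; P] := by
  rw [hB.covariance_gridIncrement]
  refine mul_nonneg (by positivity) ?_
  set x : ℝ := (j : ℝ) - k
  have hmid : |x| ≤ (1 / 2 : ℝ) • |x + 1| + (1 / 2 : ℝ) • |x - 1| := by
    have h := abs_add_le (x + 1) (x - 1)
    rw [add_add_sub_cancel, ← two_mul, abs_mul, abs_two] at h
    simp only [smul_eq_mul]
    linarith
  have hconvex := (convexOn_rpow (by linarith : 1 ≤ 2 * H)).2 (abs_nonneg (x + 1))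
    (abs_nonneg (x - 1)) one_half_pos.le one_half_pos.le (add_halves 1)
  have := (Real.rpow_le_rpow (abs_nonneg x) hmid (by linarith)).trans hconvex
  simp only [smul_eq_mul] at this
  linarith

lemma sum_covariance_gridIncrement (hB : IsFractionalBrownianMotion H B P) (dt : ℝ≥0) {n k : ℕ}
    (hk : k < n) :
    ∑ j ∈ Finset.range n, cov[gridIncrement B dt j, gridIncrement B dt k; P] =
      (dt : ℝ) ^ (2 * H) / 2 * (((n : ℝ) - k) ^ (2 * H) - ((n : ℝ) - k - 1) ^ (2 * H)
        + (((k : ℝ) + 1) ^ (2 * H) - (k : ℝ) ^ (2 * H))) := by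
  let u (j : ℕ) : ℝ := |(j : ℝ) - k| ^ (2 * H) - |(j : ℝ) - k - 1| ^ (2 * H)
  have hkn : (k : ℝ) + 1 ≤ n := by exact_mod_cast hk
  have hun : u n = ((n : ℝ) - k) ^ (2 * H) - ((n : ℝ) - k - 1) ^ (2 * H) := by
    simp only [u]
    rw [abs_of_nonneg (by linarith), abs_of_nonneg (by linarith)]
  have hu0 : u 0 = (k : ℝ) ^ (2 * H) - ((k : ℝ) + 1) ^ (2 * H) := by
    simp only [u]
    rw [Nat.cast_zero, zero_sub, ← neg_add', abs_neg, abs_neg, abs_of_nonneg (by positivity),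
      abs_of_nonneg (by positivity)]
  calc ∑ j ∈ Finset.range n, cov[gridIncrement B dt j, gridIncrement B dt k; P]
      = ∑ j ∈ Finset.range n, (dt : ℝ) ^ (2 * H) / 2 * (u (j + 1) - u j) := by
        refine Finset.sum_congr rfl fun j _ => ?_
        simp only [hB.covariance_gridIncrement, u]
        rw [Nat.cast_succ, add_sub_right_comm, add_sub_cancel_right]
        ring
    _ = _ := by
        rw [← Finset.mul_sum, Finset.sum_range_sub, hun, hu0]
        ring

lemma sum_abs_covariance_gridIncrement_le (hB : IsFractionalBrownianMotion H B P)
    (hH : 1 / 2 ≤ H) (dt : ℝ≥0) {n k : ℕ} (hk : k < n) :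
    ∑ j ∈ Finset.range n, |cov[gridIncrement B dt j, gridIncrement B dt k; P]| ≤
      (dt : ℝ) ^ (2 * H) * (2 * H) * (n : ℝ) ^ (2 * H - 1) := by
  simp only [abs_of_nonneg (hB.covariance_gridIncrement_nonneg hH dt _ _),
    hB.sum_covariance_gridIncrement dt hk]
  have hkn : (k : ℝ) + 1 ≤ n := by exact_mod_cast hk
  have hdiff {x : ℝ} (hx : 1 ≤ x) (hxn : x ≤ n) :
      x ^ (2 * H) - (x - 1) ^ (2 * H) ≤ 2 * H * (n : ℝ) ^ (2 * H - 1) :=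
    (rpow_sub_rpow_sub_one_le (by linarith) hx).trans (by gcongr; linarith)
  have hright := hdiff (x := n - k) (by linarith) (by linarith [k.cast_nonneg (α := ℝ)])
  have hleft := hdiff (x := k + 1) (by linarith [k.cast_nonneg (α := ℝ)]) hkn
  rw [add_sub_cancel_right] at hleft
  calc _ ≤ (dt : ℝ) ^ (2 * H) / 2 *
        (2 * H * (n : ℝ) ^ (2 * H - 1) + 2 * H * (n : ℝ) ^ (2 * H - 1)) := by gcongr
    _ = _ := by ring

lemma eventually_integral_prod_exp_abs_le (hB : IsFractionalBrownianMotion H B P)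
    (hH : 1 / 2 ≤ H) (hH1 : H < 1) (dt : ℝ≥0) {c : ℕ → ℝ}
    (hc : (fun k => c k ^ 2) =o[atTop] fun k : ℕ => (k : ℝ) ^ (1 - 2 * H)) {δ : ℝ} (hδ : 0 < δ) :
    ∀ᶠ n : ℕ in atTop, ∫ ω, ∏ k ∈ Finset.range n, Real.exp |c k * gridIncrement B dt k ω| ∂P ≤
      Real.exp (n * δ) := by
  set D := (1 + Real.log 2 / (δ / 2)) ^ 2 / 2 * ((dt : ℝ) ^ (2 * H) * (2 * H))
  have hsum : (fun n => ∑ k ∈ Finset.range n, c k ^ 2) =o[atTop] fun n : ℕ =>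
      (n : ℝ) ^ (2 - 2 * H) :=
    isLittleO_sum_range_rpow (by linarith) (by linarith) (by convert hc using 3; ring)
  have hsmall : (fun n : ℕ => D * ((n : ℝ) ^ (2 * H - 1) * ∑ k ∈ Finset.range n, c k ^ 2))
      =o[atTop] fun n : ℕ => (n : ℝ) := by
    refine (((Asymptotics.isBigO_refl _ _).mul_isLittleO hsum).const_mul_left D).congr'
      .rfl ?_
    filter_upwards [eventually_gt_atTop 0] with n hn
    rw [← Real.rpow_add (by exact_mod_cast hn)]
    ring_nf
    exact Real.rpow_one _
  filter_upwards [hsmall.bound (half_pos hδ)] with n hn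
  rw [Real.norm_natCast] at hn
  refine (integral_prod_exp_abs_mul_le (hB.isGaussianProcess_gridIncrement dt)
    (hB.integral_gridIncrement dt) (fun k hk => hB.sum_abs_covariance_gridIncrement_le hH dt
      (Finset.mem_range.1 hk)) (half_pos hδ) c).trans (Real.exp_le_exp.2 ?_)
  rw [Finset.card_range]
  calc _ = n * (δ / 2) + D * ((n : ℝ) ^ (2 * H - 1) * ∑ k ∈ Finset.range n, c k ^ 2) := by
        simp only [D]
        ring
    _ ≤ n * (δ / 2) + δ / 2 * n := add_le_add_right ((le_abs_self _).trans hn) _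
    _ = n * δ := by ring

lemma meanSquareStable_of_abs_le_prod (hB : IsFractionalBrownianMotion H B P)
    (hH : 1 / 2 ≤ H) (hH1 : H < 1) {dt : ℝ≥0} {X : ℕ → Ω → ℝ} (hX : ∀ n, AEMeasurable (X n) P)
    {r c : ℕ → ℝ} {C ρ : ℝ} (hr0 : ∀ k, 0 ≤ r k) (hρ : ρ < 1) (hr : ∀ᶠ k in atTop, r k ≤ ρ)
    (hc : (fun k => c k ^ 2) =o[atTop] fun k : ℕ => (k : ℝ) ^ (1 - 2 * H))
    (hbound : ∀ n, ∀ᵐ ω ∂P, |X n ω| ≤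
      C * ∏ k ∈ Finset.range n, r k * Real.exp |c k * gridIncrement B dt k ω|) :
    MeanSquareStable P X := by
  set V := gridIncrement B dt
  set E : ℕ → Ω → ℝ := fun n ω => ∏ k ∈ Finset.range n, Real.exp |2 * c k * V k ω|
  have hE (n : ℕ) : Integrable (E n) P :=
    integrable_prod_exp_abs_mul (hB.isGaussianProcess_gridIncrement dt) _ _
  have hsq (n : ℕ) : ∀ᵐ ω ∂P, |X n ω| ^ 2 ≤ C ^ 2 * (∏ k ∈ Finset.range n, r k ^ 2) * E n ω := by
    filter_upwards [hbound n] with ω hω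
    refine (pow_le_pow_left₀ (abs_nonneg _) hω 2).trans_eq ?_
    simp only [E, mul_pow, ← Finset.prod_pow, mul_assoc, ← Finset.prod_mul_distrib,
      ← Real.exp_nat_mul, abs_mul _ (c _ * _), abs_two, Nat.cast_ofNat]
  obtain ⟨δ, hδ, hρδ⟩ : ∃ δ > 0, ρ * Real.exp δ < 1 := by
    have hcont : ContinuousWithinAt (fun δ => ρ * Real.exp δ) (Set.Ioi 0) 0 := by fun_prop
    have hev := hcont.eventually_lt_const (by simpa using hρ : ρ * Real.exp 0 < 1)
    exact (hev.and self_mem_nhdsWithin).exists.imp fun δ h => ⟨h.2, h.1⟩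
  have hlim : Tendsto (fun n => C ^ 2 * ∏ k ∈ Finset.range n, r k ^ 2 * Real.exp δ) atTop
      (𝓝 0) := by
    rw [← mul_zero (C ^ 2)]
    refine (tendsto_prod_range_zero_of_eventually_le (fun k => by positivity) hρδ ?_).const_mul _
    filter_upwards [hr] with k hk
    gcongr
    exact (pow_le_of_le_one (hr0 k) (hk.trans hρ.le) two_ne_zero).trans hk
  have hc2 : (fun k => (2 * c k) ^ 2) =o[atTop] fun k : ℕ => (k : ℝ) ^ (1 - 2 * H) := by
    simpa only [mul_pow] using hc.const_mul_left (2 ^ 2)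
  refine meanSquareStable_of_ae_sq_le hX (fun n => (hE n).const_mul _) hsq
    (squeeze_zero' (.of_forall fun n => integral_nonneg fun ω => by positivity) ?_ hlim)
  filter_upwards [hB.eventually_integral_prod_exp_abs_le hH hH1 dt hc2 hδ] with n hn
  calc ∫ ω, C ^ 2 * (∏ k ∈ Finset.range n, r k ^ 2) * E n ω ∂P
      ≤ C ^ 2 * (∏ k ∈ Finset.range n, r k ^ 2) * Real.exp (n * δ) := by
        rw [integral_const_mul]
        gcongr
    _ = C ^ 2 * ∏ k ∈ Finset.range n, r k ^ 2 * Real.exp δ := by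
        rw [Finset.prod_mul_distrib, Finset.prod_const, Finset.card_range, Real.exp_nat_mul,
          mul_assoc]

end IsFractionalBrownianMotion

section Damping

lemma exists_lt_one_eventually_one_add_mul_div_le {ι : Type*} {l : Filter ι} {b : ι → ℝ}
    (hb : Tendsto b l atTop) {ρ : ℝ} (hρ : ρ < 1) :
    ∃ ρ' < 1, ∀ᶠ n in l, (1 + ρ * b n) / (1 + b n) ≤ ρ' := by
  refine ⟨(1 + ρ) / 2, by linarith, ?_⟩
  filter_upwards [hb.eventually_ge_atTop 1] with n hn
  rw [div_le_iff₀ (by linarith)]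
  linarith [mul_le_mul_of_nonneg_left hn (sub_nonneg.2 hρ.le)]

lemma isLittleO_sq_div_one_add_mul_rpow {α p s : ℝ} (hα : 0 < α) (hs : -(2 * p) < s) (m : ℝ) :
    (fun k : ℕ => (m / (1 + α * (k : ℝ) ^ p)) ^ 2) =o[atTop] fun k : ℕ => (k : ℝ) ^ s := by
  have hdecay : (fun k : ℕ => (m / (1 + α * (k : ℝ) ^ p)) ^ 2) =O[atTop]
      fun k : ℕ => (k : ℝ) ^ s * (k : ℝ) ^ (-(s + 2 * p)) := by
    refine .of_bound ((m / α) ^ 2) ?_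
    filter_upwards [eventually_gt_atTop 0] with k hk
    have hk0 : (0 : ℝ) < k := by exact_mod_cast hk
    have hexponent : (k : ℝ) ^ s * (k : ℝ) ^ (-(s + 2 * p)) = ((k : ℝ) ^ p)⁻¹ ^ 2 := by
      rw [← Real.rpow_add hk0, ← Real.rpow_neg hk0.le, ← Real.rpow_mul_natCast hk0.le]
      push_cast
      ring_nf
    rw [Real.norm_of_nonneg (by positivity), Real.norm_of_nonneg (by positivity), hexponent,
      ← mul_pow, ← div_eq_mul_inv, div_div, div_pow, div_pow]
    gcongr
    exact le_add_of_nonneg_left zero_le_one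
  have hvanish : (fun k : ℕ => (k : ℝ) ^ (-(s + 2 * p))) =o[atTop] fun _ : ℕ => (1 : ℝ) :=
    (Asymptotics.isLittleO_one_iff ℝ).2
      ((tendsto_rpow_neg_atTop (by linarith)).comp tendsto_natCast_atTop_atTop)
  simpa only [mul_one] using hdecay.trans_isLittleO
    ((Asymptotics.isBigO_refl (fun k : ℕ => (k : ℝ) ^ s) atTop).mul_isLittleO hvanish)

/-- The damping `b_n = θ λ κ t_n^{κ-1} Δt` that the implicit part of the stochastic theta method
exerts at time `t_n`: solving for `X_n` divides the explicit data by at least `1 + b_n`. -/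
noncomputable def damping (κ lam θ : ℝ) (dt : ℝ≥0) (n : ℕ) : ℝ :=
  θ * (lam * κ * (gridTime dt n : ℝ) ^ (κ - 1)) * dt

variable {κ lam θ : ℝ} {dt : ℝ≥0}

lemma gridTime_succ_pos (hdt : 0 < dt) (n : ℕ) : (0 : ℝ) < gridTime dt (n + 1) := by
  rw [gridTime]
  positivity

lemma damping_eq_mul_rpow (κ lam θ : ℝ) (dt : ℝ≥0) (n : ℕ) :
    damping κ lam θ dt n = damping κ lam θ dt 1 * (n : ℝ) ^ (κ - 1) := by
  simp only [damping, gridTime, NNReal.coe_mul, NNReal.coe_natCast, Nat.cast_one, one_mul]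
  rw [Real.mul_rpow n.cast_nonneg dt.coe_nonneg]
  ring

lemma damping_nonneg (hκ : 0 ≤ κ) (hlam : 0 ≤ lam) (hθ : 0 ≤ θ) (n : ℕ) :
    0 ≤ damping κ lam θ dt n := by
  unfold damping
  positivity

lemma damping_one_pos (hκ : 0 < κ) (hlam : 0 < lam) (hθ : 0 < θ) (hdt : 0 < dt) :
    0 < damping κ lam θ dt 1 := by
  simp only [damping, gridTime, Nat.cast_one, one_mul]
  positivity

lemma damping_zero (hκ : κ ≠ 1) : damping κ lam θ dt 0 = 0 := by
  simp [damping, gridTime, Real.zero_rpow (sub_ne_zero.2 hκ)]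

lemma damping_monotone (hκ : 1 ≤ κ) (hlam : 0 ≤ lam) (hθ : 0 ≤ θ) :
    Monotone (damping κ lam θ dt) := by
  intro m n hmn
  rw [damping_eq_mul_rpow _ _ _ _ m, damping_eq_mul_rpow _ _ _ _ n]
  have := damping_nonneg (dt := dt) (zero_le_one.trans hκ) hlam hθ 1
  gcongr

lemma tendsto_damping_atTop (hκ : 1 < κ) (hlam : 0 < lam) (hθ : 0 < θ) (hdt : 0 < dt) :
    Tendsto (damping κ lam θ dt) atTop atTop := by
  rw [funext (damping_eq_mul_rpow κ lam θ dt)]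
  exact ((tendsto_rpow_atTop (sub_pos.2 hκ)).comp tendsto_natCast_atTop_atTop).const_mul_atTop
    (damping_one_pos (zero_lt_one.trans hκ) hlam hθ hdt)

end Damping

section ImplicitStep

lemma abs_mul_one_add_le_of_implicit_step {x y F L d : ℝ} (hd : 0 ≤ d)
    (hF : x * F ≤ -L * x ^ 2) (hstep : x = y + F * d) : |x| * (1 + L * d) ≤ |y| := by
  rcases eq_or_ne x 0 with rfl | hx
  · simp
  refine le_of_mul_le_mul_left ?_ (abs_pos.2 hx)
  have hexpand : x ^ 2 = x * y + x * F * d := by linear_combination x * hstep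
  calc |x| * (|x| * (1 + L * d)) = x ^ 2 - -L * x ^ 2 * d := by
        rw [← mul_assoc, abs_mul_abs_self]
        ring
    _ ≤ x ^ 2 - x * F * d := by gcongr
    _ = x * y := by rw [hexpand, add_sub_cancel_right]
    _ ≤ |x| * |y| := by rw [← abs_mul]; exact le_abs_self _

lemma le_mul_exp_of_mul_one_add_le {A b ρ m v z : ℝ} (hA : 0 ≤ A) (hb : 0 ≤ b) (hρ : 0 ≤ ρ)
    (hm : 0 ≤ m) (h : z * (1 + b) ≤ A * (1 + ρ * b + m * |v|)) :
    z ≤ A * ((1 + ρ * b) / (1 + b) * Real.exp |m / (1 + ρ * b) * v|) := by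
  have hexp : 1 + ρ * b + m * |v| ≤ (1 + ρ * b) * Real.exp |m / (1 + ρ * b) * v| := by
    calc 1 + ρ * b + m * |v| = (1 + ρ * b) * (|m / (1 + ρ * b) * v| + 1) := by
          rw [abs_mul, abs_of_nonneg (by positivity : 0 ≤ m / (1 + ρ * b))]
          field_simp
          ring
      _ ≤ _ := by gcongr; exact Real.add_one_le_exp _
  rw [div_mul_eq_mul_div, ← mul_div_assoc, le_div_iff₀ (by positivity)]
  exact h.trans (by gcongr)

lemma abs_add_mul_le_mul_one_add {m : ℝ} (hm : 0 < m) (y a v : ℝ) :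
    |y + a * v| ≤ (|y| + |a| / m) * (1 + m * |v|) := by
  calc |y + a * v| ≤ |y| + |a| * |v| := (abs_add_le _ _).trans_eq (by rw [abs_mul])
    _ ≤ |y| + |a| * |v| + (|a| / m + |y| * (m * |v|)) := le_add_of_nonneg_right (by positivity)
    _ = _ := by
        field_simp
        ring

end ImplicitStep

namespace IsStochasticThetaMethod

variable {Ω : Type*} [MeasurableSpace Ω] {P : Measure Ω} {B : ℝ≥0 → Ω → ℝ} {X : ℕ → Ω → ℝ}
  {f g : ℝ → ℝ → ℝ} {κ lam μ θ ρ x₀ : ℝ} {dt : ℝ≥0}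

/-- Weakening the resolvent factor `1 + b_{n+1}` to `1 + b_n` pairs it with the explicit factor
`1 + ρ b_n` of the same step, so that only ratios of equal index enter the product bound. -/
lemma ae_abs_mul_one_add_damping_le (hX : IsStochasticThetaMethod P f g B θ dt x₀ X)
    (hf : MonotoneCondition κ lam f) (hκ : 1 ≤ κ) (hlam : 0 ≤ lam) (hθ : 0 ≤ θ) (hdt : 0 < dt)
    (n : ℕ) : ∀ᵐ ω ∂P, |X (n + 1) ω| * (1 + damping κ lam θ dt n) ≤
      |X n ω + (1 - θ) * f (gridTime dt n) (X n ω) * dt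
        + g (gridTime dt n) (X n ω) * gridIncrement B dt n ω| := by
  filter_upwards [hX.step n] with ω hω
  have hmono := mul_le_mul_of_nonneg_left (hf _ (X (n + 1) ω) (gridTime_succ_pos hdt n)) hθ
  calc |X (n + 1) ω| * (1 + damping κ lam θ dt n)
      ≤ |X (n + 1) ω| * (1 + damping κ lam θ dt (n + 1)) := by
        gcongr
        exact damping_monotone hκ hlam hθ n.le_succ
    _ ≤ _ := abs_mul_one_add_le_of_implicit_step dt.coe_nonneg
        (F := θ * f (gridTime dt (n + 1)) (X (n + 1) ω)) (by linarith) (by linarith)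

/-- At `t_0 = 0` the growth conditions say nothing about `f` and `g`, so the first step is absorbed
into the constant `C`. -/
lemma exists_ae_abs_le_mul_prod (hX : IsStochasticThetaMethod P f g B θ dt x₀ X)
    (hf : MonotoneCondition κ lam f) (hg : UniformLinearGrowth μ g) (hκ : 1 < κ) (hlam : 0 ≤ lam)
    (hμ : 0 < μ) (hθ : 0 ≤ θ) (hρ : 0 ≤ ρ) (hdt : 0 < dt)
    (hexplicit : ∀ t x : ℝ, 0 < t →
      |(1 - θ) * f t x| ≤ ρ * (θ * (lam * κ * t ^ (κ - 1))) * |x|) :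
    ∃ C, ∀ n, ∀ᵐ ω ∂P, |X n ω| ≤ C * ∏ k ∈ Finset.range n,
      (1 + ρ * damping κ lam θ dt k) / (1 + damping κ lam θ dt k) *
        Real.exp |μ / (1 + ρ * damping κ lam θ dt k) * gridIncrement B dt k ω| := by
  set b := damping κ lam θ dt
  have hb (n : ℕ) : 0 ≤ b n := damping_nonneg (by linarith) hlam hθ n
  have hb0 : b 0 = 0 := damping_zero hκ.ne'
  set C := |x₀ + (1 - θ) * f (gridTime dt 0) x₀ * dt| + |g (gridTime dt 0) x₀| / μ
  have hC : 0 ≤ C := by positivity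
  refine ⟨|x₀| + C, fun n => ?_⟩
  filter_upwards [hX.initial, ae_all_iff.2 fun k =>
    hX.ae_abs_mul_one_add_damping_le hf hκ.le hlam hθ hdt k] with ω hinit hstep
  refine le_mul_prod_range (x := fun n => |X n ω|) (fun k => ?_) ?_ ?_ (fun k => ?_) n
  · have := hb k
    positivity
  · simpa only [hinit] using le_add_of_nonneg_right hC
  · refine le_mul_exp_of_mul_one_add_le (by positivity) (hb 0) hρ hμ.le ((hstep 0).trans ?_)
    rw [hinit, hb0, mul_zero, add_zero]
    refine (abs_add_mul_le_mul_one_add hμ _ _ _).trans ?_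
    gcongr ?_ * _
    exact le_add_of_nonneg_left (abs_nonneg x₀)
  · refine le_mul_exp_of_mul_one_add_le (abs_nonneg _) (hb _) hρ hμ.le ((hstep (k + 1)).trans ?_)
    have ht := gridTime_succ_pos hdt k
    have hdrift := mul_le_mul_of_nonneg_right (hexplicit _ (X (k + 1) ω) ht) dt.coe_nonneg
    have hnoise := mul_le_mul_of_nonneg_right (hg _ (X (k + 1) ω) ht)
      (abs_nonneg (gridIncrement B dt (k + 1) ω))
    refine (abs_add_three _ _ _).trans ?_
    rw [abs_mul _ (dt : ℝ), NNReal.abs_eq, abs_mul (g _ _)]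
    simp only [b, damping]
    linarith

lemma meanSquareStable (hX : IsStochasticThetaMethod P f g B θ dt x₀ X) {H : ℝ}
    (hB : IsFractionalBrownianMotion H B P) (hH : 1 / 2 ≤ H) (hH1 : H < 1)
    (hf : MonotoneCondition κ lam f) (hg : UniformLinearGrowth μ g) (hκ : H + 1 / 2 < κ)
    (hlam : 0 < lam) (hμ : 0 < μ) (hθ : 0 < θ) (hρ : 0 < ρ) (hρ1 : ρ < 1) (hdt : 0 < dt)
    (hexplicit : ∀ t x : ℝ, 0 < t →
      |(1 - θ) * f t x| ≤ ρ * (θ * (lam * κ * t ^ (κ - 1))) * |x|) :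
    MeanSquareStable P X := by
  have hκ1 : 1 < κ := by linarith
  obtain ⟨C, hC⟩ := hX.exists_ae_abs_le_mul_prod hf hg hκ1 hlam.le hμ hθ.le hρ.le hdt hexplicit
  obtain ⟨ρ', hρ', hr⟩ := exists_lt_one_eventually_one_add_mul_div_le
    (tendsto_damping_atTop hκ1 hlam hθ hdt) hρ1
  refine hB.meanSquareStable_of_abs_le_prod hH hH1 hX.aemeasurable (fun k => ?_) hρ' hr ?_ hC
  · have := damping_nonneg (dt := dt) (by linarith : 0 ≤ κ) hlam.le hθ.le k
    positivity
  · refine (isLittleO_sq_div_one_add_mul_rpow (α := ρ * damping κ lam θ dt 1) (p := κ - 1)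
      (mul_pos hρ (damping_one_pos (by linarith) hlam hθ hdt)) (by linarith) μ).congr_left
      fun k => ?_
    rw [damping_eq_mul_rpow κ lam θ dt k, mul_assoc]

lemma meanSquareStable_backwardEuler (hX : IsStochasticThetaMethod P f g B 1 dt x₀ X) {H : ℝ}
    (hB : IsFractionalBrownianMotion H B P) (hH : 1 / 2 ≤ H) (hH1 : H < 1)
    (hf : MonotoneCondition κ lam f) (hg : UniformLinearGrowth μ g) (hκ : H + 1 / 2 < κ)
    (hlam : 0 < lam) (hμ : 0 < μ) (hdt : 0 < dt) : MeanSquareStable P X := by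
  have hκ0 : 0 < κ := by linarith
  refine hX.meanSquareStable hB hH hH1 hf hg hκ hlam hμ one_pos one_half_pos one_half_lt_one hdt
    fun t x ht => ?_
  rw [sub_self, zero_mul, abs_zero]
  positivity

lemma meanSquareStable_of_driftLinearGrowth (hX : IsStochasticThetaMethod P f g B θ dt x₀ X)
    {H lamBar : ℝ} (hB : IsFractionalBrownianMotion H B P) (hH : 1 / 2 ≤ H) (hH1 : H < 1)
    (hf : MonotoneCondition κ lam f) (hg : UniformLinearGrowth μ g) (hκ : H + 1 / 2 < κ)
    (hlam : 0 < lam) (hμ : 0 < μ) (hdt : 0 < dt) (hgrowth : DriftLinearGrowth κ lamBar f)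
    (hθ : |1 - θ| * lamBar < θ * lam) : MeanSquareStable P X := by
  have hκ0 : 0 < κ := by linarith
  have hlamBar : 0 ≤ lamBar := by
    have h := (abs_nonneg _).trans (hgrowth 1 1 one_pos)
    rw [Real.one_rpow, abs_one, mul_one, mul_one] at h
    exact nonneg_of_mul_nonneg_left h hκ0
  have hθlam : 0 < θ * lam := (by positivity : 0 ≤ |1 - θ| * lamBar).trans_lt hθ
  have hθ0 : 0 < θ := pos_of_mul_pos_left hθlam hlam.le
  obtain ⟨ρ, hρ, hρ1⟩ := exists_between ((div_lt_one hθlam).2 hθ)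
  have hρ0 : 0 < ρ := (by positivity : 0 ≤ |1 - θ| * lamBar / (θ * lam)).trans_lt hρ
  refine hX.meanSquareStable hB hH hH1 hf hg hκ hlam hμ hθ0 hρ0 hρ1 hdt fun t x ht => ?_
  calc |(1 - θ) * f t x| ≤ |1 - θ| * (lamBar * κ * t ^ (κ - 1) * |x|) := by
        rw [abs_mul]
        gcongr
        exact hgrowth t x ht
    _ = |1 - θ| * lamBar * (κ * t ^ (κ - 1) * |x|) := by ring
    _ ≤ ρ * (θ * lam) * (κ * t ^ (κ - 1) * |x|) := by
        gcongr ?_ * _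
        exact ((div_lt_iff₀ hθlam).1 hρ).le
    _ = _ := by ring

end IsStochasticThetaMethod

lemma abs_one_sub_mul_lt_of_mul_div_le {q lam lamBar θ : ℝ} (hq : 1 < q) (hlam : 0 < lam)
    (hlamBar : 0 < lamBar) (hθ : q * (lamBar / lam) / (q * (lamBar / lam) + 1) ≤ θ)
    (hθ1 : θ < 1) : |1 - θ| * lamBar < θ * lam := by
  rw [div_le_iff₀ (by positivity)] at hθ
  have hθ1' : 0 < 1 - θ := sub_pos.2 hθ1
  calc |1 - θ| * lamBar = (1 - θ) * (1 * (lamBar / lam)) * lam := by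
        rw [abs_of_pos hθ1']
        field_simp
    _ < (1 - θ) * (q * (lamBar / lam)) * lam := by gcongr
    _ ≤ θ * lam := by
        gcongr
        linarith

lemma one_lt_sqrt_six_mul_exp_one : 1 < √6 * Real.exp 1 :=
  one_lt_mul_of_lt_of_le (Real.lt_sqrt_of_sq_lt (by norm_num)) (Real.one_le_exp zero_le_one)

theorem theorem2_general {Ω : Type*} [MeasurableSpace Ω] (P : Measure Ω) (H : ℝ)
    (hH : 1 / 2 ≤ H) (hH1 : H < 1) (B : ℝ≥0 → Ω → ℝ) (hB : IsFractionalBrownianMotion H B P)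
    (κ lam μ : ℝ) (hκ : H + 1 / 2 < κ) (hlam : 0 < lam) (hμ : 0 < μ) (f g : ℝ → ℝ → ℝ)
    (hf : MonotoneCondition κ lam f) (hg : UniformLinearGrowth μ g) (dt : ℝ≥0) (hdt : 0 < dt)
    (x₀ : ℝ) :
    (∀ X : ℕ → Ω → ℝ, IsStochasticThetaMethod P f g B 1 dt x₀ X → MeanSquareStable P X) ∧
    (∀ lamBar : ℝ, DriftLinearGrowth κ lamBar f → ∀ θ : ℝ, |1 - θ| * lamBar < θ * lam →
      ∀ X : ℕ → Ω → ℝ, IsStochasticThetaMethod P f g B θ dt x₀ X → MeanSquareStable P X) :=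
  ⟨fun _ hX => hX.meanSquareStable_backwardEuler hB hH hH1 hf hg hκ hlam hμ hdt,
    fun _ hgrowth _ hθ _ hX =>
      hX.meanSquareStable_of_driftLinearGrowth hB hH hH1 hf hg hκ hlam hμ hdt hgrowth hθ⟩

theorem theorem2 {Ω : Type*} [MeasurableSpace Ω] (P : Measure Ω) [IsProbabilityMeasure P]
    (H : ℝ) (hH : 1 / 2 < H) (hH1 : H < 1)
    (B : ℝ≥0 → Ω → ℝ) (hB : IsFractionalBrownianMotion H B P)
    (κ lam μ : ℝ) (hκ : 2 * H ≤ κ) (hlam : 0 < lam) (hμ : 0 < μ)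
    (hstab : (2 * H < κ ∧ 0 < lam) ∨ (κ = 2 * H ∧ -lam + μ ^ 2 < 0))
    (f g : ℝ → ℝ → ℝ) (hf : MonotoneCondition κ lam f) (hg : UniformLinearGrowth μ g)
    (dt : ℝ≥0) (hdt : 0 < dt) (x₀ : ℝ) :
    (∀ X : ℕ → Ω → ℝ, IsStochasticThetaMethod P f g B 1 dt x₀ X → MeanSquareStable P X) ∧
    (∀ lamBar : ℝ, 0 < lamBar → DriftLinearGrowth κ lamBar f →
      ∀ θ : ℝ, √6 * Real.exp 1 * (lamBar / lam) / (√6 * Real.exp 1 * (lamBar / lam) + 1) ≤ θ →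
        θ < 1 →
        ∀ X : ℕ → Ω → ℝ, IsStochasticThetaMethod P f g B θ dt x₀ X → MeanSquareStable P X) := by
  obtain ⟨hEuler, htheta⟩ := theorem2_general P H hH.le hH1 B hB κ lam μ (by linarith) hlam hμ f g
    hf hg dt hdt x₀
  exact ⟨hEuler, fun lamBar hlamBar hgrowth θ hθ hθ1 => htheta lamBar hgrowth θ
    (abs_one_sub_mul_lt_of_mul_div_le one_lt_sqrt_six_mul_exp_one hlam hlamBar hθ hθ1)⟩
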